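/- Let $\mathcal C$ and $\mathcal D$ be monoidal model categories (the tensor product $\wedge$ is biclosed, and the pushout-product axiom and the unit axiom hold; symmetry is not assumed). Let $F\colon\mathcal C\rightleftarrows\mathcal D\colon R$ be a Quillen adjunction whose left adjoint $F$ is a strong monoidal functor, and let $E$ be a cofibrant object of $\mathcal C$. For an object $A$ of a monoidal model category $\mathcal M$, the $A$-local model structure $L_A\mathcal M$, if it exists, is the model structure on the category underlying $\mathcal M$ in which a map $f\colon X\to Y$ is a weak equivalence if and only if $\mathrm{id}_A\wedge f\colon A\wedge X\to A\wedge Y$ is a weak equivalence of $\mathcal M$, the cofibrations are those of $\mathcal M$, and the fibrations are the maps with the right lifting property with respect to all trivial cofibrations of $L_A\mathcal M$. Assume that $L_E\mathcal C$ and $L_{F(E)}\mathcal D$ exist. Then: 1. The functors $F$ and $R$ form a strong monoidal Quillen adjunction $F\colon L_E\mathcal C\rightleftarrows L_{F(E)}\mathcal D\colon R$. That is, $F$ (which is strong monoidal) preserves cofibrations and trivial cofibrations of the localised model structures, and for every trivial fibration $q\colon Q\to 1_{\mathcal C}$ of $L_E\mathcal C$ with $Q$ cofibrant, the composite $F(Q)\to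 F(1_{\mathcal C})\cong 1_{\mathcal D}$ is a weak equivalence of $L_{F(E)}\mathcal D$. 2. If $F\dashv R$ is a Quillen equivalence between $\mathcal C$ and $\mathcal D$, then it is also a Quillen equivalence between $L_E\mathcal C$ and $L_{F(E)}\mathcal D$. 3. If the monoidal category $\mathcal C$ is braided (in particular, if it is symmetric), then $L_E\mathcal C$ is a monoidal model category; likewise, if $\mathcal D$ is braided, then $L_{F(E)}\mathcal D$ is a monoidal model category. If $\mathcal C$ and $\mathcal D$ are symmetric and $F$ is strong symmetric monoidal, then $F\colon L_E\mathcal C\rightleftarrows L_{F(E)}\mathcal D\colon R$ is a strong symmetric monoidal Quillen adjunction between symmetric monoidal model categories. -/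

import Mathlib

open CategoryTheory Limits MonoidalCategory HomotopicalAlgebra

/-! Several model structures on one category are compared, so model structures are explicit
arguments below instead of instances. -/

universe v₁ v₂ u₁ u₂

section ModelStructures

variable {C : Type u₁} [Category.{v₁} C] {D : Type u₂} [Category.{v₂} D]

/-- `X` is cofibrant in the model structure `M`. -/
def CofibrantIn (M : ModelCategory C) (X : C) : Prop := IsCofibrant X

/-- `X` is fibrant in the model structure `M`. -/
def FibrantIn (M : ModelCategory C) (X : C) : Prop := IsFibrant X

/-- `f` is a cofibration in the model structure `M`. -/
def IsCof (M : ModelCategory C) {X Y : C} (f : X ⟶ Y) : Prop := Cofibration f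

/-- `f` is a fibration in the model structure `M`. -/
def IsFib (M : ModelCategory C) {X Y : C} (f : X ⟶ Y) : Prop := Fibration f

/-- `f` is a weak equivalence in the model structure `M`. -/
def IsWeq (M : ModelCategory C) {X Y : C} (f : X ⟶ Y) : Prop := WeakEquivalence f

/-- `F ⊣ R` is a Quillen adjunction: `F` preserves cofibrations and trivial cofibrations. -/
structure IsQuillenAdjunction (MC : ModelCategory C) (MD : ModelCategory D)
    {F : C ⥤ D} {R : D ⥤ C} (adj : F ⊣ R) : Prop where
  map_cof : ∀ {X Y : C} (f : X ⟶ Y), IsCof MC f → IsCof MD (F.map f)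
  map_trivialCof : ∀ {X Y : C} (f : X ⟶ Y), IsCof MC f → IsWeq MC f →
    IsCof MD (F.map f) ∧ IsWeq MD (F.map f)

/-- `F ⊣ R` is a Quillen equivalence: a Quillen adjunction such that, for `X` cofibrant and `Y`
fibrant, a map `F X ⟶ Y` is a weak equivalence if and only if its adjoint `X ⟶ R Y` is one. -/
structure IsQuillenEquivalence (MC : ModelCategory C) (MD : ModelCategory D)
    {F : C ⥤ D} {R : D ⥤ C} (adj : F ⊣ R) : Prop extends IsQuillenAdjunction MC MD adj where
  weq_iff : ∀ (X : C) (Y : D), CofibrantIn MC X → FibrantIn MD Y → ∀ f : F.obj X ⟶ Y,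
    IsWeq MD f ↔ IsWeq MC (adj.homEquiv X Y f)

variable [MonoidalCategory C] [MonoidalCategory D]

/-- The pushout-product `A ⊗ Y ⨿_{A ⊗ X} B ⊗ X ⟶ B ⊗ Y` of `f : A ⟶ B` and `g : X ⟶ Y`, as an
object of the arrow category (pushouts exist because `M` is a model structure). -/
noncomputable def pushoutProd (M : ModelCategory C) {A B X Y : C} (f : A ⟶ B) (g : X ⟶ Y) :
    CategoryTheory.Arrow C :=
  (MonoidalCategory.Arrow.pushoutProduct.obj (CategoryTheory.Arrow.mk f)).obj
    (CategoryTheory.Arrow.mk g)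

/-- The model structure `M` makes the monoidal category `C` a monoidal model category: the tensor
product is closed on both sides, and the pushout-product axiom and the unit axiom hold. -/
structure IsMonoidalModelCategory (M : ModelCategory C) : Prop where
  tensorLeft_isLeftAdjoint : ∀ X : C, (tensorLeft X).IsLeftAdjoint
  tensorRight_isLeftAdjoint : ∀ X : C, (tensorRight X).IsLeftAdjoint
  pushoutProd_cof : ∀ {A B X Y : C} (f : A ⟶ B) (g : X ⟶ Y), IsCof M f → IsCof M g →
    IsCof M (pushoutProd M f g).hom
  pushoutProd_weq : ∀ {A B X Y : C} (f : A ⟶ B) (g : X ⟶ Y), IsCof M f → IsCof M g →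
    (IsWeq M f ∨ IsWeq M g) → IsWeq M (pushoutProd M f g).hom
  unit_weq : ∀ {Q : C} (q : Q ⟶ 𝟙_ C), CofibrantIn M Q → IsFib M q → IsWeq M q →
    ∀ X : C, CofibrantIn M X → IsWeq M (q ▷ X) ∧ IsWeq M (X ◁ q)

/-- `ML` is the `E`-local model structure `L_E C` attached to the model structure `M` on `C`.
That `L_E C` exists means that there is such an `ML`; it is then unique. -/
structure IsLocalModelStructure (M : ModelCategory C) (E : C) (ML : ModelCategory C) : Prop where
  weq_iff : ∀ {X Y : C} (f : X ⟶ Y), IsWeq ML f ↔ IsWeq M (E ◁ f)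
  cof_iff : ∀ {X Y : C} (f : X ⟶ Y), IsCof ML f ↔ IsCof M f
  fib_iff : ∀ {X Y : C} (p : X ⟶ Y), IsFib ML p ↔
    ∀ {A B : C} (i : A ⟶ B), IsCof ML i → IsWeq ML i → HasLiftingProperty i p

/-- `F ⊣ R` is a strong monoidal Quillen adjunction: a Quillen adjunction whose left adjoint is
strong monoidal and sends a cofibrant replacement of the unit to a weak equivalence. -/
structure IsStrongMonoidalQuillenAdjunction (MC : ModelCategory C) (MD : ModelCategory D)
    {F : C ⥤ D} [F.Monoidal] {R : D ⥤ C} (adj : F ⊣ R) : Prop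
    extends IsQuillenAdjunction MC MD adj where
  unit_weq : ∀ {Q : C} (q : Q ⟶ 𝟙_ C), CofibrantIn MC Q → IsFib MC q → IsWeq MC q →
    IsWeq MD (F.map q ≫ Functor.OplaxMonoidal.η F)

/-- The strong monoidal functor `F` is symmetric: it is compatible with the braidings. -/
def PreservesBraiding [BraidedCategory C] [BraidedCategory D] (F : C ⥤ D) [F.Monoidal] : Prop :=
  ∀ X Y : C, Functor.LaxMonoidal.μ F X Y ≫ F.map (β_ X Y).hom =
    (β_ (F.obj X) (F.obj Y)).hom ≫ Functor.LaxMonoidal.μ F Y X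

/-- `F ⊣ R` is a strong symmetric monoidal Quillen adjunction between symmetric monoidal model
categories. -/
structure IsStrongSymmetricMonoidalQuillenAdjunction [SymmetricCategory C] [SymmetricCategory D]
    (MC : ModelCategory C) (MD : ModelCategory D)
    {F : C ⥤ D} [F.Monoidal] {R : D ⥤ C} (adj : F ⊣ R) : Prop
    extends IsStrongMonoidalQuillenAdjunction MC MD adj where
  source : IsMonoidalModelCategory MC
  target : IsMonoidalModelCategory MD
  symmetric : PreservesBraiding F

end ModelStructures

section ModelStructureAPI

variable {C : Type u₁} [Category.{v₁} C] {D : Type u₂} [Category.{v₂} D]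

lemma IsWeq.iff_of_arrowIso (M : ModelCategory C) {X Y X' Y' : C} {f : X ⟶ Y} {g : X' ⟶ Y'}
    (e : Arrow.mk f ≅ Arrow.mk g) : IsWeq M f ↔ IsWeq M g := by
  simp only [IsWeq, weakEquivalence_iff]
  exact (weakEquivalences C).arrow_mk_iso_iff e

lemma IsCof.iff_of_arrowIso (M : ModelCategory C) {X Y X' Y' : C} {f : X ⟶ Y} {g : X' ⟶ Y'}
    (e : Arrow.mk f ≅ Arrow.mk g) : IsCof M f ↔ IsCof M g := by
  simp only [IsCof, cofibration_iff]
  exact (cofibrations C).arrow_mk_iso_iff e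

lemma IsWeq.comp_iff_left {M : ModelCategory C} {X Y Z : C} {f : X ⟶ Y} {g : Y ⟶ Z}
    (hg : IsWeq M g) : IsWeq M (f ≫ g) ↔ IsWeq M f := by
  have : WeakEquivalence g := hg
  exact weakEquivalence_postcomp_iff f g

lemma IsWeq.comp_iff_right {M : ModelCategory C} {X Y Z : C} {f : X ⟶ Y} {g : Y ⟶ Z}
    (hf : IsWeq M f) : IsWeq M (f ≫ g) ↔ IsWeq M g := by
  have : WeakEquivalence f := hf
  exact weakEquivalence_precomp_iff f g

lemma IsWeq.comp {M : ModelCategory C} {X Y Z : C} {f : X ⟶ Y} {g : Y ⟶ Z}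
    (hf : IsWeq M f) (hg : IsWeq M g) : IsWeq M (f ≫ g) :=
  hg.comp_iff_left.2 hf

lemma cofibrantIn_iff_of_isInitial (M : ModelCategory C) {I X : C} (hI : IsInitial I)
    (i : I ⟶ X) : CofibrantIn M X ↔ IsCof M i :=
  isCofibrant_iff_of_isInitial i hI

/-- Trivial fibrations are determined by the cofibrations. -/
lemma trivialFib_iff_forall_cof (M : ModelCategory C) {X Y : C} (p : X ⟶ Y) :
    (IsFib M p ∧ IsWeq M p) ↔
      ∀ {A B : C} (i : A ⟶ B), IsCof M i → HasLiftingProperty i p := by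
  have h : trivialFibrations C p ↔ IsFib M p ∧ IsWeq M p := mem_trivialFibrations_iff p
  rw [← h, ← cofibrations_rlp]
  exact ⟨fun hp _ _ i hi ↦ hp i hi.mem, fun hp _ _ i hi ↦ hp i ⟨hi⟩⟩

lemma fib_iff_forall_trivialCof (M : ModelCategory C) {X Y : C} (p : X ⟶ Y) :
    IsFib M p ↔
      ∀ {A B : C} (i : A ⟶ B), IsCof M i → IsWeq M i → HasLiftingProperty i p := by
  have h : fibrations C p ↔ IsFib M p := (fibration_iff p).symm
  rw [← h, ← trivialCofibrations_rlp]
  exact ⟨fun hp _ _ i hi hi' ↦ hp i ⟨hi.mem, hi'.mem⟩, fun hp _ _ i hi ↦ hp i ⟨hi.1⟩ ⟨hi.2⟩⟩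

lemma exists_trivialCof_fib_fac (M : ModelCategory C) {X Y : C} (f : X ⟶ Y) :
    ∃ (Z : C) (i : X ⟶ Z) (p : Z ⟶ Y),
      IsCof M i ∧ IsWeq M i ∧ IsFib M p ∧ i ≫ p = f := by
  let d := MorphismProperty.factorizationData (trivialCofibrations C) (fibrations C) f
  exact ⟨d.Z, d.i, d.p, ⟨d.hi.1⟩, ⟨d.hi.2⟩, ⟨d.hp⟩, d.fac⟩

lemma exists_cofibrant_replacement (M : ModelCategory C) (X : C) :
    ∃ (Q : C) (q : Q ⟶ X), CofibrantIn M Q ∧ IsFib M q ∧ IsWeq M q := by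
  let d := MorphismProperty.factorizationData (cofibrations C) (trivialFibrations C)
    (initial.to X)
  exact ⟨d.Z, d.p, (cofibrantIn_iff_of_isInitial M initialIsInitial d.i).2 ⟨d.hi⟩,
    ⟨d.hp.1⟩, ⟨d.hp.2⟩⟩

lemma exists_fibrant_replacement (M : ModelCategory C) (X : C) :
    ∃ (Y : C) (j : X ⟶ Y), FibrantIn M Y ∧ IsWeq M j := by
  obtain ⟨Y, j, p, -, hj, hp, -⟩ := exists_trivialCof_fib_fac M (terminal.from X)
  exact ⟨Y, j, (isFibrant_iff_of_isTerminal p terminalIsTerminal).2 hp, hj⟩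

lemma exists_lift_of_cofibrantIn (M : ModelCategory C) {A X Y : C} (hA : CofibrantIn M A)
    (p : X ⟶ Y) (hp : IsFib M p) (hp' : IsWeq M p) (f : A ⟶ Y) : ∃ g : A ⟶ X, g ≫ p = f := by
  have := (trivialFib_iff_forall_cof M p).1 ⟨hp, hp'⟩ (initial.to A) hA
  have sq : CommSq (initial.to X) (initial.to A) p f := ⟨Subsingleton.elim _ _⟩
  exact ⟨sq.lift, sq.fac_right⟩

variable {MC : ModelCategory C} {MD : ModelCategory D} {F : C ⥤ D} {R : D ⥤ C} {adj : F ⊣ R}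

lemma IsQuillenAdjunction.map_cofibrantIn (hadj : IsQuillenAdjunction MC MD adj) {X : C}
    (hX : CofibrantIn MC X) : CofibrantIn MD (F.obj X) := by
  have := adj.leftAdjoint_preservesColimits
  exact (cofibrantIn_iff_of_isInitial MD (initialIsInitial.isInitialObj F _)
    (F.map (initial.to X))).2 (hadj.map_cof _ hX)

/-- Ken Brown's lemma. -/
lemma IsQuillenAdjunction.map_weq (hadj : IsQuillenAdjunction MC MD adj) {X Y : C}
    (hX : CofibrantIn MC X) (hY : CofibrantIn MC Y) {f : X ⟶ Y} (hf : IsWeq MC f) :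
    IsWeq MD (F.map f) := by
  have : IsCofibrant X := hX
  have : IsCofibrant Y := hY
  have : WeakEquivalence f := hf
  let h : CofibrantBrownFactorization f := Classical.arbitrary _
  have hs : IsWeq MD (F.map h.s) :=
    (hadj.map_trivialCof h.s h.cofibration_s (inferInstanceAs (WeakEquivalence h.s))).2
  have hi : IsWeq MD (F.map h.i) :=
    (hadj.map_trivialCof h.i ⟨h.hi⟩ (inferInstanceAs (WeakEquivalence h.i))).2
  have hp : IsWeq MD (F.map h.p) := by
    rw [← hs.comp_iff_right, ← F.map_comp, h.s_p, F.map_id]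
    exact inferInstanceAs (WeakEquivalence (𝟙 _))
  rw [← h.fac, F.map_comp]
  exact hi.comp hp

lemma IsQuillenEquivalence.map_weq_iff (hadj : IsQuillenEquivalence MC MD adj) {X Y : C}
    (hX : CofibrantIn MC X) (hY : CofibrantIn MC Y) (f : X ⟶ Y) :
    IsWeq MD (F.map f) ↔ IsWeq MC f := by
  obtain ⟨Z, j, hZ, hj⟩ := exists_fibrant_replacement MD (F.obj Y)
  rw [← hj.comp_iff_left, hadj.weq_iff X Z hX hZ, Adjunction.homEquiv_naturality_left,
    ((hadj.weq_iff Y Z hY hZ j).1 hj).comp_iff_left]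

end ModelStructureAPI

section MonoidalModelCategories

variable {C : Type u₁} [Category.{v₁} C] [MonoidalCategory C]

/-- Whiskering with `E` is the pushout-product with `⊥_ C ⟶ E`. -/
lemma nonempty_whiskerLeft_iso_pushoutProd {M : ModelCategory C}
    (hM : IsMonoidalModelCategory M) (E : C) {X Y : C} (f : X ⟶ Y) :
    Nonempty (Arrow.mk (E ◁ f) ≅ Arrow.mk (pushoutProd M (initial.to E) f).hom) := by
  have h (Z : C) : PreservesColimitsOfShape (Discrete PEmpty.{1})
      ((curriedTensor C).flip.obj Z) := by
    have := hM.tensorRight_isLeftAdjoint Z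
    exact (Adjunction.ofIsLeftAdjoint (tensorRight Z)).leftAdjoint_preservesColimits.1
  have := h X
  have := h Y
  let sq := Functor.PushoutObjObj.ofIsInitialLeft (curriedTensor C) (initial.to E) f
    initialIsInitial
  let sq' := Functor.PushoutObjObj.ofHasPushout (curriedTensor C) (initial.to E) f
  let e := sq.isPushout.isoIsPushout _ _ sq'.isPushout
  refine ⟨Arrow.isoMk e (Iso.refl _) (sq.hom_ext ?_ ?_)⟩
  · have h₁ : sq.inl ≫ e.hom = sq'.inl := 
      IsPushout.inl_isoIsPushout_hom _ _ sq.isPushout sq'.isPushout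
    have h₂ : sq'.inl ≫ sq'.ι = E ◁ f := sq'.inl_ι
    change sq.inl ≫ e.hom ≫ sq'.ι = 𝟙 _ ≫ E ◁ f ≫ 𝟙 _
    rw [reassoc_of% h₁, h₂, Category.id_comp, Category.comp_id]
  · exact (initialIsInitial.isInitialObj ((curriedTensor C).flip.obj Y) _).hom_ext _ _

lemma IsMonoidalModelCategory.whiskerLeft_cof {M : ModelCategory C}
    (hM : IsMonoidalModelCategory M) {E : C} (hE : CofibrantIn M E) {X Y : C} {f : X ⟶ Y}
    (hf : IsCof M f) : IsCof M (E ◁ f) :=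
  (IsCof.iff_of_arrowIso M (nonempty_whiskerLeft_iso_pushoutProd hM E f).some).2
    (hM.pushoutProd_cof _ f hE hf)

lemma IsMonoidalModelCategory.whiskerLeft_weq {M : ModelCategory C}
    (hM : IsMonoidalModelCategory M) {E : C} (hE : CofibrantIn M E) {X Y : C} {f : X ⟶ Y}
    (hf : IsCof M f) (hf' : IsWeq M f) : IsWeq M (E ◁ f) :=
  (IsWeq.iff_of_arrowIso M (nonempty_whiskerLeft_iso_pushoutProd hM E f).some).2
    (hM.pushoutProd_weq _ f hE hf (Or.inr hf'))

lemma IsMonoidalModelCategory.tensor_cofibrantIn {M : ModelCategory C}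
    (hM : IsMonoidalModelCategory M) {E X : C} (hE : CofibrantIn M E) (hX : CofibrantIn M X) :
    CofibrantIn M (E ⊗ X) := by
  have := hM.tensorLeft_isLeftAdjoint E
  have : PreservesColimitsOfSize.{0, 0} (tensorLeft E) :=
    (Adjunction.ofIsLeftAdjoint (tensorLeft E)).leftAdjoint_preservesColimits
  exact (cofibrantIn_iff_of_isInitial M (initialIsInitial.isInitialObj (tensorLeft E) _)
    (E ◁ initial.to X)).2 (hM.whiskerLeft_cof hE hX)

variable {M ML : ModelCategory C} {E : C}

lemma IsLocalModelStructure.cofibrantIn_iff (hL : IsLocalModelStructure M E ML) (X : C) :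
    CofibrantIn ML X ↔ CofibrantIn M X := by
  rw [cofibrantIn_iff_of_isInitial ML initialIsInitial (initial.to X), hL.cof_iff]
  rfl

lemma IsLocalModelStructure.trivialFib_iff (hL : IsLocalModelStructure M E ML) {X Y : C}
    (p : X ⟶ Y) : (IsFib ML p ∧ IsWeq ML p) ↔ (IsFib M p ∧ IsWeq M p) := by
  simp only [trivialFib_iff_forall_cof, hL.cof_iff]

lemma IsLocalModelStructure.weq_of_weq (hL : IsLocalModelStructure M E ML)
    (hM : IsMonoidalModelCategory M) (hE : CofibrantIn M E) {X Y : C} {f : X ⟶ Y}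
    (hf : IsWeq M f) : IsWeq ML f := by
  obtain ⟨Z, i, p, hi, hi', hp, rfl⟩ := exists_trivialCof_fib_fac M f
  rw [hi'.comp_iff_right] at hf
  exact ((hL.weq_iff i).2 (hM.whiskerLeft_weq hE hi hi')).comp
    ((hL.trivialFib_iff p).2 ⟨hp, hf⟩).2

lemma IsLocalModelStructure.fibrantIn (hL : IsLocalModelStructure M E ML)
    (hM : IsMonoidalModelCategory M) (hE : CofibrantIn M E) {X : C} (hX : FibrantIn ML X) :
    FibrantIn M X := by
  have hX' : IsFib ML (terminal.from X) := hX
  exact (fib_iff_forall_trivialCof M _).2 fun i hi hi' ↦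
    (hL.fib_iff _).1 hX' i ((hL.cof_iff i).2 hi) (hL.weq_of_weq hM hE hi')

lemma IsMonoidalModelCategory.isWeq_whiskerLeft_pushoutProd (hM : IsMonoidalModelCategory M)
    (hE : CofibrantIn M E) {A B X Y : C} {f : A ⟶ B} {g : X ⟶ Y} (hf : IsCof M f)
    (hg : IsCof M g) (hf' : IsWeq M (E ◁ f)) : IsWeq M (E ◁ (pushoutProd M f g).hom) := by
  have := hM.tensorLeft_isLeftAdjoint E
  have : PreservesColimitsOfSize.{0, 0} (tensorLeft E) :=
    (Adjunction.ofIsLeftAdjoint (tensorLeft E)).leftAdjoint_preservesColimits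
  let e := MonoidalCategory.Arrow.PushoutProduct.whiskerLeftIso (W := E) (Arrow.mk f) (Arrow.mk g)
  exact (IsWeq.iff_of_arrowIso M e).2
    (hM.pushoutProd_weq (E ◁ f) g (hM.whiskerLeft_cof hE hf) hg (Or.inl hf'))

/-- A local model structure on a braided monoidal model category is monoidal. -/
lemma IsLocalModelStructure.isMonoidalModelCategory [BraidedCategory C]
    (hL : IsLocalModelStructure M E ML) (hM : IsMonoidalModelCategory M)
    (hE : CofibrantIn M E) : IsMonoidalModelCategory ML where
  tensorLeft_isLeftAdjoint := hM.tensorLeft_isLeftAdjoint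
  tensorRight_isLeftAdjoint := hM.tensorRight_isLeftAdjoint
  pushoutProd_cof f g hf hg :=
    (hL.cof_iff _).2 (hM.pushoutProd_cof f g ((hL.cof_iff f).1 hf) ((hL.cof_iff g).1 hg))
  pushoutProd_weq f g hf hg h := by
    rw [hL.cof_iff] at hf hg
    simp only [hL.weq_iff] at h ⊢
    obtain h | h := h
    · exact hM.isWeq_whiskerLeft_pushoutProd hE hf hg h
    · let e : pushoutProd M f g ≅ pushoutProd M g f :=
        MonoidalCategory.Arrow.PushoutProduct.braiding (Arrow.mk f) (Arrow.mk g)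
      exact (IsWeq.iff_of_arrowIso M ((tensorLeft E).mapArrow.mapIso e)).2
        (hM.isWeq_whiskerLeft_pushoutProd hE hg hf h)
  unit_weq q hQ hq hq' X hX := by
    obtain ⟨h, h'⟩ := (hL.trivialFib_iff q).1 ⟨hq, hq'⟩
    rw [hL.cofibrantIn_iff] at hQ hX
    obtain ⟨h₁, h₂⟩ := hM.unit_weq q hQ h h' X hX
    exact ⟨hL.weq_of_weq hM hE h₁, hL.weq_of_weq hM hE h₂⟩

variable {D : Type u₂} [Category.{v₂} D] [MonoidalCategory D]
  {MC LC : ModelCategory C} {MD LD : ModelCategory D}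
  {F : C ⥤ D} [F.Monoidal] {R : D ⥤ C} {adj : F ⊣ R}

open Functor.OplaxMonoidal

/-- A strong monoidal functor `F` sends `E ◁ f` to `F E ◁ F f`, up to isomorphism. -/
lemma isWeq_whiskerLeft_map_iff (MD : ModelCategory D) (F : C ⥤ D) [F.Monoidal] (E : C) {X Y : C}
    (f : X ⟶ Y) : IsWeq MD (F.obj E ◁ F.map f) ↔ IsWeq MD (F.map (E ◁ f)) :=
  IsWeq.iff_of_arrowIso MD (Arrow.isoMk (Functor.Monoidal.μIso F E X) (Functor.Monoidal.μIso F E Y)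
    (by simp))

lemma IsQuillenAdjunction.local (hadj : IsQuillenAdjunction MC MD adj)
    (hC : IsMonoidalModelCategory MC) (hE : CofibrantIn MC E)
    (hLC : IsLocalModelStructure MC E LC) (hLD : IsLocalModelStructure MD (F.obj E) LD) :
    IsQuillenAdjunction LC LD adj where
  map_cof f hf := (hLD.cof_iff _).2 (hadj.map_cof f ((hLC.cof_iff f).1 hf))
  map_trivialCof f hf hf' := by
    rw [hLC.cof_iff] at hf
    rw [hLC.weq_iff] at hf'
    rw [hLD.cof_iff, hLD.weq_iff, isWeq_whiskerLeft_map_iff]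
    exact ⟨hadj.map_cof f hf, (hadj.map_trivialCof _ (hC.whiskerLeft_cof hE hf) hf').2⟩

lemma IsQuillenAdjunction.local_isStrongMonoidal (hadj : IsQuillenAdjunction MC MD adj)
    (hC : IsMonoidalModelCategory MC) (hE : CofibrantIn MC E)
    (hLC : IsLocalModelStructure MC E LC) (hLD : IsLocalModelStructure MD (F.obj E) LD) :
    IsStrongMonoidalQuillenAdjunction LC LD adj where
  toIsQuillenAdjunction := hadj.local hC hE hLC hLD
  unit_weq {Q} q hQ hq hq' := by
    obtain ⟨h, h'⟩ := (hLC.trivialFib_iff q).1 ⟨hq, hq'⟩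
    rw [hLC.cofibrantIn_iff] at hQ
    have hη : IsWeq LD (η F) := inferInstanceAs (WeakEquivalence (η F))
    rw [hη.comp_iff_left, hLD.weq_iff, isWeq_whiskerLeft_map_iff]
    have hE' : CofibrantIn MC (E ⊗ 𝟙_ C) :=
      (cofibrantIn_iff_of_isInitial MC initialIsInitial (initial.to E ≫ (ρ_ E).inv)).2
        ((IsCof.iff_of_arrowIso MC (f := initial.to E ≫ (ρ_ E).inv) (g := initial.to E)
          (Arrow.isoMk (Iso.refl _) (ρ_ E) (Subsingleton.elim (α := (⊥_ C) ⟶ E) _ _))).2 hE)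
    exact hadj.map_weq (hC.tensor_cofibrantIn hE hQ) hE' (hC.unit_weq q hQ h h' E hE).2

lemma IsQuillenEquivalence.local (hadj : IsQuillenEquivalence MC MD adj)
    (hC : IsMonoidalModelCategory MC) (hD : IsMonoidalModelCategory MD) (hE : CofibrantIn MC E)
    (hLC : IsLocalModelStructure MC E LC) (hLD : IsLocalModelStructure MD (F.obj E) LD) :
    IsQuillenEquivalence LC LD adj where
  toIsQuillenAdjunction := hadj.toIsQuillenAdjunction.local hC hE hLC hLD
  weq_iff X Y hX hY f := by
    have hFE := hadj.map_cofibrantIn hE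
    rw [hLC.cofibrantIn_iff] at hX
    replace hY := hLD.fibrantIn hD hFE hY
    obtain ⟨Q, q, hQ, hq, hq'⟩ := exists_cofibrant_replacement MC (R.obj Y)
    obtain ⟨g, hg⟩ := exists_lift_of_cofibrantIn MC hX q hq hq' (adj.homEquiv X Y f)
    have hf : F.map g ≫ (adj.homEquiv Q Y).symm q = f := by
      rw [← Adjunction.homEquiv_naturality_left_symm, hg, Equiv.symm_apply_apply]
    have hq'' : IsWeq MD ((adj.homEquiv Q Y).symm q) := by
      rwa [hadj.weq_iff Q Y hQ hY, Equiv.apply_symm_apply]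
    rw [← hg, ← hf, (hLD.weq_of_weq hD hFE hq'').comp_iff_left,
      (hLC.weq_of_weq hC hE hq').comp_iff_left, hLD.weq_iff, hLC.weq_iff,
      isWeq_whiskerLeft_map_iff,
      hadj.map_weq_iff (hC.tensor_cofibrantIn hE hX) (hC.tensor_cofibrantIn hE hQ)]

end MonoidalModelCategories

theorem mainTheorem9
    {C : Type u₁} [Category.{v₁} C] [MonoidalCategory C]
    {D : Type u₂} [Category.{v₂} D] [MonoidalCategory D]
    (MC : ModelCategory C) (MD : ModelCategory D)
    (hC : IsMonoidalModelCategory MC) (hD : IsMonoidalModelCategory MD)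
    {F : C ⥤ D} [F.Monoidal] {R : D ⥤ C} (adj : F ⊣ R)
    (hadj : IsQuillenAdjunction MC MD adj)
    (E : C) (hE : CofibrantIn MC E)
    (LC : ModelCategory C) (hLC : IsLocalModelStructure MC E LC)
    (LD : ModelCategory D) (hLD : IsLocalModelStructure MD (F.obj E) LD) :
    IsStrongMonoidalQuillenAdjunction LC LD adj ∧
    (IsQuillenEquivalence MC MD adj → IsQuillenEquivalence LC LD adj) ∧
    (∀ _ : BraidedCategory C, IsMonoidalModelCategory LC) ∧
    (∀ _ : BraidedCategory D, IsMonoidalModelCategory LD) ∧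
    (∀ (_ : SymmetricCategory C) (_ : SymmetricCategory D), PreservesBraiding F →
      IsStrongSymmetricMonoidalQuillenAdjunction LC LD adj) := by
  have hFE := hadj.map_cofibrantIn hE
  have h := hadj.local_isStrongMonoidal hC hE hLC hLD
  exact ⟨h, fun hadj' ↦ hadj'.local hC hD hE hLC hLD,
    fun _ ↦ hLC.isMonoidalModelCategory hC hE, fun _ ↦ hLD.isMonoidalModelCategory hD hFE,
    fun _ _ hF ↦
      { toIsStrongMonoidalQuillenAdjunction := h
        source := hLC.isMonoidalModelCategory hC hE
        target := hLD.isMonoidalModelCategory hD hFE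
        symmetric := hF }⟩
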